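/- Let $G$ be a topological group (multiplication and inversion are continuous), and let $G_d$ be $G$ with the discrete topology. Let $\beta G_d$ be the Stone–Čech compactification of $G_d$, that is, the set of all ultrafilters on $G$ with the topology having base $\{\langle A\rangle: A\subseteq G\}$, where $\langle A\rangle=\{u\in\beta G_d: A\in u\}$; it is a semigroup under $$A\in uv\iff\{s\in G:\{t\in G: st\in A\}\in v\}\in u ,$$ and $x\in G$ is identified with the principal ultrafilter at $x$. An ultrafilter $u$ on $G$ is called Schur if for each $U\in u$ there are $x,y\in U$ (possibly equal) with $xy\in U$. Let $\Psi$ be the least congruence on the semigroup $\beta G_d$ that is closed in $\beta G_d\times\beta G_d$ and contains $(u,1_G)$ for every Schur ultrafilter $u$ on $G$ and for every ultrafilter $u$ on $G$ that converges to $1_G$ in the topology of $G$. Equip $\beta G_d/\Psi$ with the quotient topology and the multiplication $[u]_\Psi[v]_\Psi=[uv]_\Psi$, and let $\mathfrak h_\Psi: G\to\beta G_d/\Psi$, $\mathfrak h_\Psi(x)=[x]_\Psi$. Then $(\beta G_d/\Psi,\mathfrak h_\Psi)$ is the Bohr compactification of $G$. That is, $\beta G_d/\Psi$ is a compact Hausdorff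 topological group, $\mathfrak h_\Psi$ is a continuous homomorphism with dense image, and for every compact Hausdorff topological group $H$ and every continuous homomorphism $f:G\to H$ there is a continuous homomorphism $g:\beta G_d/\Psi\to H$ with $f=g\circ\mathfrak h_\Psi$. -/

import Mathlib

open Filter Topology

-- The semigroup structure on the space `Ultrafilter M` of all ultrafilters on a semigroup `M`:
-- `A ∈ u * v ↔ {s | {t | s * t ∈ A} ∈ v} ∈ u`.
attribute [local instance] Ultrafilter.semigroup

universe u v w

namespace BohrUltrafilter

/-- The least closed congruence on the semigroup `S` (with a topology) that contains the
relation `R`: the intersection of all congruences containing `R` that are closed in `S × S`. -/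
def leastClosedCon {S : Type u} [Semigroup S] [TopologicalSpace S] (R : S → S → Prop) : Con S :=
  sInf {c : Con S | IsClosed {p : S × S | c p.1 p.2} ∧ ∀ x y, R x y → c x y}

/-- `leastClosedCon R` is indeed the least element among the closed congruences containing `R`. -/
theorem isLeast_leastClosedCon {S : Type u} [Semigroup S] [TopologicalSpace S]
    (R : S → S → Prop) :
    IsLeast {c : Con S | IsClosed {p : S × S | c p.1 p.2} ∧ ∀ x y, R x y → c x y}
      (leastClosedCon R) := by
  refine ⟨⟨?_, ?_⟩, fun c hc => sInf_le hc⟩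
  · have h : {p : S × S | leastClosedCon R p.1 p.2} =
        ⋂ c ∈ {c : Con S | IsClosed {p : S × S | c p.1 p.2} ∧ ∀ x y, R x y → c x y},
          {p : S × S | c p.1 p.2} := by
      ext p
      simp only [Set.mem_iInter]
      exact Iff.rfl
    rw [h]
    exact isClosed_biInter fun c hc => hc.1
  · intro x y hxy c hc
    exact hc.2 x y hxy

/-- The quotient of a semigroup with a topology by a congruence carries the quotient topology. -/
instance quotientTopology {S : Type u} [Semigroup S] [TopologicalSpace S] (c : Con S) :
    TopologicalSpace c.Quotient :=
  TopologicalSpace.coinduced (fun x : S => (x : c.Quotient)) inferInstance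

/-- An ultrafilter `p` on a group is Schur if every `U ∈ p` contains some `x`, `y` (possibly equal)
together with their product `x * y`. -/
def IsSchur {G : Type u} [Group G] (p : Ultrafilter G) : Prop :=
  ∀ U ∈ p, ∃ x ∈ U, ∃ y ∈ U, x * y ∈ U

/-- The congruence `Ψ` on the Stone-Čech compactification `Ultrafilter G` of the discrete group
underlying the topological group `G`: the least closed congruence that identifies with the
principal ultrafilter at `1` every Schur ultrafilter and every ultrafilter converging to `1` in
the topology of `G`. -/
def Psi (G : Type u) [Group G] [TopologicalSpace G] : Con (Ultrafilter G) :=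
  leastClosedCon fun p q => (IsSchur p ∨ (p : Filter G) ≤ 𝓝 (1 : G)) ∧ q = pure 1

/-- A group `B` with a topology and a homomorphism `b : G →* B` form the Bohr compactification of
the topological group `G`, where compact groups are understood to be Hausdorff. The test groups
`H` range over an arbitrary universe. -/
structure IsBohrCompactification {G : Type u} [Group G] [TopologicalSpace G]
    {B : Type v} [Group B] [TopologicalSpace B] (b : G →* B) : Prop where
  isTopologicalGroup : IsTopologicalGroup B
  compactSpace : CompactSpace B
  t2Space : T2Space B
  continuous : Continuous b
  denseRange : DenseRange b
  exists_lift : ∀ (H : Type w) [Group H] [TopologicalSpace H] [IsTopologicalGroup H]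
    [CompactSpace H] [T2Space H] (f : G →* H), Continuous f →
      ∃ g : B →* H, Continuous g ∧ ∀ x, g (b x) = f x

end BohrUltrafilter

/-! Idempotent ultrafilters are Schur, so `Psi` sends them to `1`. If `c * p * c = c`, then `c * p`
is idempotent; hence every class has a left inverse and the quotient is a group. The product of
ultrafilters is not jointly continuous, but its class depends only on the marginals of any
ultrafilter on `G × G` (`coe_map_mul`, from `isSchur_mul_mul`). Pushforward along multiplication is
continuous, so the quotient is a topological group. For the universal property, the extension of `f`
to ultrafilters is a continuous homomorphism whose kernel is a closed congruence containing the
generators of `Psi`. -/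

theorem t2Space_of_isQuotientMap_of_isClosed {X : Type u} {Y : Type v} [TopologicalSpace X] [CompactSpace X]
    [T2Space X] [TopologicalSpace Y] {π : X → Y} (hπ : IsQuotientMap π)
    (hR : IsClosed {p : X × X | π p.1 = π p.2}) : T2Space Y := by
  have hclosed : IsClosedMap π := by
    intro C hC
    rw [← hπ.isClosed_preimage]
    -- The saturation of a closed set is the projection of a closed set along a compact factor.
    have h : π ⁻¹' (π '' C) = Prod.snd '' ({p : X × X | π p.1 = π p.2} ∩ Prod.fst ⁻¹' C) := by
      ext x
      constructor
      · rintro ⟨y, hy, hyx⟩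
        exact ⟨(y, x), ⟨hyx, hy⟩, rfl⟩
      · rintro ⟨⟨y, z⟩, ⟨hyz, hy⟩, rfl⟩
        exact ⟨y, hy, hyz⟩
    rw [h]
    exact isClosedMap_snd_of_compactSpace _ (hR.inter (hC.preimage continuous_fst))
  have hsingleton : ∀ y : Y, IsClosed ({y} : Set Y) := by
    intro y
    obtain ⟨x, rfl⟩ := hπ.surjective y
    simpa using hclosed _ (isClosed_singleton (x := x))
  refine ⟨fun a b hab => ?_⟩
  obtain ⟨U, V, hU, hV, haU, hbV, hUV⟩ := normal_separation
    ((hsingleton a).preimage hπ.continuous) ((hsingleton b).preimage hπ.continuous)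
    ((Set.disjoint_singleton.2 hab).preimage π)
  -- These sets consist of the points whose whole fibre lies in `U`, respectively `V`.
  refine ⟨(π '' Uᶜ)ᶜ, (π '' Vᶜ)ᶜ, (hclosed _ hU.isClosed_compl).isOpen_compl,
    (hclosed _ hV.isClosed_compl).isOpen_compl, ?_, ?_, ?_⟩
  · rintro ⟨x, hx, rfl⟩
    exact hx (haU rfl)
  · rintro ⟨x, hx, rfl⟩
    exact hx (hbV rfl)
  · rw [Set.disjoint_left]
    intro y hyU hyV
    obtain ⟨x, rfl⟩ := hπ.surjective y
    have hxU : x ∈ U := by_contra fun h => hyU ⟨x, h, rfl⟩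
    have hxV : x ∈ V := by_contra fun h => hyV ⟨x, h, rfl⟩
    exact Set.disjoint_left.1 hUV hxU hxV

/-- In a compact right topological semigroup every element `w` has a weak inverse `c`: an
idempotent for the twisted product `(y, z) ↦ y * w * z`. -/
theorem exists_mul_mul_eq_self {S : Type u} [Semigroup S] [TopologicalSpace S] [CompactSpace S]
    [T2Space S] (hS : ∀ r : S, Continuous (· * r)) (w : S) : ∃ c : S, c * w * c = c := by
  have hassoc (x y z : S) : x * w * y * w * z = x * w * (y * w * z) := by simp only [mul_assoc]
  exact @exists_idempotent_of_compact_t2_of_continuous_mul_left S ⟨w⟩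
    { mul := fun y z => y * w * z, mul_assoc := hassoc } _ _ _ fun r => (hS r).comp (hS w)

namespace BohrUltrafilter

variable {G : Type u} [Group G]

theorem pure_one_mul (p : Ultrafilter G) : pure 1 * p = p :=
  Ultrafilter.coe_inj.mp <| Filter.ext' fun P => by
    rw [Ultrafilter.eventually_mul]
    simp

theorem isSchur_of_mul_self_eq {p : Ultrafilter G} (hp : p * p = p) : IsSchur p := by
  intro U hU
  have h : ∀ᶠ x in (p : Filter G), ∀ᶠ y in (p : Filter G), x * y ∈ U := by
    rw [← Ultrafilter.eventually_mul, hp]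
    exact hU
  obtain ⟨x, hx, hxU⟩ := (h.and hU).exists
  obtain ⟨y, hy, hyU⟩ := (hx.and hU).exists
  exact ⟨x, hxU, y, hyU, hy⟩

/-- If `u` and `v` are the marginals of an ultrafilter `r` on `G × G`, and `w` is its image under
multiplication, then every weak inverse `c` of `w` makes `v * c * u` Schur. -/
theorem isSchur_mul_mul (r : Ultrafilter (G × G)) {c : Ultrafilter G}
    (hc : c * r.map (fun z => z.1 * z.2) * c = c) :
    IsSchur (r.map Prod.snd * c * r.map Prod.fst) := by
  set u := r.map Prod.fst
  set v := r.map Prod.snd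
  set w := r.map (fun z => z.1 * z.2)
  intro U hU
  have h₁ : ∀ᶠ g in ((v * c : Ultrafilter G) : Filter G),
      ∀ᶠ z in (r : Filter (G × G)), g * z.1 ∈ U :=
    (Ultrafilter.eventually_mul (v * c) u (· ∈ U)).1 hU
  have h₂ : ∀ᶠ z in (r : Filter (G × G)),
      ∀ᶠ h in ((c * u : Ultrafilter G) : Filter G), z.2 * h ∈ U :=
    (Ultrafilter.eventually_mul v (c * u) (· ∈ U)).1 (by rw [← mul_assoc]; exact hU)
  have h₃ : ∀ᶠ g in ((v * c : Ultrafilter G) : Filter G), ∀ᶠ z in (r : Filter (G × G)),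
      ∀ᶠ h in ((c * u : Ultrafilter G) : Filter G), g * ((z.1 * z.2) * h) ∈ U := by
    -- Inserting `w` between two copies of `c` changes nothing, so `U` also catches `g * z.1 * z.2 *
    -- h`, the product of `g * z.1` and `z.2 * h`.
    have he : (v * c) * (w * (c * u)) = v * c * u := by
      calc (v * c) * (w * (c * u)) = v * (c * w * c) * u := by simp only [mul_assoc]
        _ = v * c * u := by rw [hc]
    have hU' : ∀ᶠ x in (((v * c) * (w * (c * u)) : Ultrafilter G) : Filter G), x ∈ U := by
      rw [he]
      exact hU
    rw [Ultrafilter.eventually_mul] at hU'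
    refine hU'.mono fun g hg => ?_
    exact (Ultrafilter.eventually_mul w (c * u) (fun x => g * x ∈ U)).1 hg
  obtain ⟨g, hg₁, hg₃⟩ := (h₁.and h₃).exists
  obtain ⟨z, ⟨hz₁, hz₂⟩, hz₃⟩ := ((hg₁.and h₂).and hg₃).exists
  obtain ⟨h, hh₂, hh₃⟩ := (hz₂.and hz₃).exists
  refine ⟨g * z.1, hz₁, z.2 * h, hh₂, ?_⟩
  simpa only [mul_assoc] using hh₃

theorem continuous_ultrafilter_map {X : Type u} {Y : Type v} (f : X → Y) :
    Continuous (Ultrafilter.map f) :=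
  ultrafilterBasis_is_basis.continuous_iff.2 <| Set.forall_mem_range.mpr fun s =>
    ultrafilter_isOpen_basic (f ⁻¹' s)

/-- Every pair of ultrafilters is the pair of marginals of an ultrafilter on the product. -/
theorem exists_map_fst_map_snd {X : Type u} {Y : Type v} (p : Ultrafilter X) (q : Ultrafilter Y) :
    ∃ r : Ultrafilter (X × Y), r.map Prod.fst = p ∧ r.map Prod.snd = q := by
  let r : Ultrafilter (X × Y) := Ultrafilter.of ((p : Filter X) ×ˢ (q : Filter Y))
  have hr : (r : Filter (X × Y)) ≤ (p : Filter X) ×ˢ (q : Filter Y) := Ultrafilter.of_le _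
  refine ⟨r, ?_, ?_⟩
  · exact Ultrafilter.coe_le_coe.1 (tendsto_fst.mono_left hr)
  · exact Ultrafilter.coe_le_coe.1 (tendsto_snd.mono_left hr)

/-- The continuous extension of a homomorphism into a compact group is multiplicative. -/
theorem extend_mul {H : Type w} [Group H] [TopologicalSpace H] [IsTopologicalGroup H]
    [CompactSpace H] [T2Space H] (f : G →* H) (p q : Ultrafilter G) :
    Ultrafilter.extend f (p * q) = Ultrafilter.extend f p * Ultrafilter.extend f q := by
  have hlim : ∀ r : Ultrafilter G, Tendsto f r (𝓝 (Ultrafilter.extend f r)) :=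
    fun r => ultrafilter_extend_eq_iff.1 rfl
  rw [ultrafilter_extend_eq_iff]
  change Tendsto f ((p * q : Ultrafilter G) : Filter G) _
  rw [tendsto_nhds]
  intro W hW hmem
  have h : ∀ᶠ x in (p : Filter G), ∀ᶠ y in (q : Filter G), f (x * y) ∈ W := by
    have h₁ := ((hlim p).mul_const (Ultrafilter.extend f q)).eventually (hW.mem_nhds hmem)
    refine h₁.mono fun x hx => ?_
    refine (((hlim q).const_mul (f x)).eventually (hW.mem_nhds hx)).mono fun y hy => ?_
    rw [map_mul]
    exact hy
  exact (Ultrafilter.eventually_mul p q (fun x => f x ∈ W)).2 h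

/-- The limit `a` must satisfy `a * a = a`: otherwise, near `a`, products of two points would be
separated from the points themselves. -/
theorem IsSchur.extend_eq_one {H : Type w} [Group H] [TopologicalSpace H] [IsTopologicalGroup H]
    [CompactSpace H] [T2Space H] (f : G →* H) {p : Ultrafilter G} (hp : IsSchur p) :
    Ultrafilter.extend f p = 1 := by
  by_contra hne
  set a := Ultrafilter.extend f p
  have hlim : Tendsto f p (𝓝 a) := ultrafilter_extend_eq_iff.1 rfl
  have haa : a * a ≠ a := fun h => hne (mul_eq_left.1 h)
  obtain ⟨V, W, hV, hW, haV, haW, hVW⟩ := t2_separation haa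
  have hmul : ∀ᶠ z in 𝓝 a ×ˢ 𝓝 a, z.1 * z.2 ∈ V := by
    rw [← nhds_prod_eq]
    exact (continuous_mul.tendsto (a, a)).eventually (hV.mem_nhds haV)
  obtain ⟨N, hN, hNV⟩ := (eventually_prod_self_iff (r := fun x y => x * y ∈ V)).1 hmul
  obtain ⟨x, hx, y, hy, hxy⟩ := hp _ (hlim (inter_mem hN (hW.mem_nhds haW)))
  refine Set.disjoint_left.1 hVW (hNV _ hx.1 _ hy.1) ?_
  rw [← map_mul]
  exact hxy.2

section Quotient

variable [TopologicalSpace G]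

theorem isClosed_Psi : IsClosed {p : Ultrafilter G × Ultrafilter G | Psi G p.1 p.2} :=
  (isLeast_leastClosedCon _).1.1

theorem IsSchur.coe_eq {p : Ultrafilter G} (hp : IsSchur p) :
    (p : (Psi G).Quotient) = ((pure 1 : Ultrafilter G) : (Psi G).Quotient) :=
  (Con.eq _).2 ((isLeast_leastClosedCon _).1.2 _ _ ⟨Or.inl hp, rfl⟩)

theorem coe_eq_of_le_nhds_one {p : Ultrafilter G} (hp : (p : Filter G) ≤ 𝓝 1) :
    (p : (Psi G).Quotient) = ((pure 1 : Ultrafilter G) : (Psi G).Quotient) :=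
  (Con.eq _).2 ((isLeast_leastClosedCon _).1.2 _ _ ⟨Or.inr hp, rfl⟩)

theorem isQuotientMap_coe : IsQuotientMap (fun p : Ultrafilter G => (p : (Psi G).Quotient)) :=
  ⟨⟨rfl⟩, Quotient.mk_surjective⟩

instance compactSpace_quotient : CompactSpace (Psi G).Quotient :=
  ⟨by
    rw [← isQuotientMap_coe.surjective.range_eq]
    exact isCompact_range isQuotientMap_coe.continuous⟩

instance t2Space_quotient : T2Space (Psi G).Quotient := by
  refine t2Space_of_isQuotientMap_of_isClosed isQuotientMap_coe ?_
  simpa only [Con.eq] using isClosed_Psi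

theorem exists_mul_coe_eq_one (q : (Psi G).Quotient) :
    ∃ q' : (Psi G).Quotient, q' * q = ((pure 1 : Ultrafilter G) : (Psi G).Quotient) := by
  obtain ⟨p, rfl⟩ := isQuotientMap_coe.surjective q
  obtain ⟨c, hc⟩ := exists_mul_mul_eq_self Ultrafilter.continuous_mul_left p
  have h : c * p * (c * p) = c * p := by rw [← mul_assoc, hc]
  exact ⟨c, (isSchur_of_mul_self_eq h).coe_eq⟩

variable (G) in
/-- The group structure on the quotient of the Stone-Čech compactification by `Psi G`. -/
noncomputable abbrev quotientGroup : Group (Psi G).Quotient :=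
  letI : One (Psi G).Quotient := ⟨((pure 1 : Ultrafilter G) : (Psi G).Quotient)⟩
  letI : Inv (Psi G).Quotient := ⟨fun q => (exists_mul_coe_eq_one q).choose⟩
  Group.ofLeftAxioms
    (fun a b c => by
      obtain ⟨a, rfl⟩ := isQuotientMap_coe.surjective a
      obtain ⟨b, rfl⟩ := isQuotientMap_coe.surjective b
      obtain ⟨c, rfl⟩ := isQuotientMap_coe.surjective c
      exact congrArg _ (mul_assoc a b c))
    (fun a => by
      obtain ⟨a, rfl⟩ := isQuotientMap_coe.surjective a
      exact congrArg _ (pure_one_mul a))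
    (fun a => (exists_mul_coe_eq_one a).choose_spec)

attribute [local instance] quotientGroup

theorem coe_pure_one : ((pure 1 : Ultrafilter G) : (Psi G).Quotient) = 1 := rfl

theorem coe_ultrafilter_mul (p q : Ultrafilter G) :
    ((p * q : Ultrafilter G) : (Psi G).Quotient) = (p : (Psi G).Quotient) * q := rfl

/-- Multiplication of classes is computed by any ultrafilter on `G × G` with the given marginals,
not only by the iterated limit that defines the product. -/
theorem coe_map_mul (r : Ultrafilter (G × G)) :
    ((r.map (fun z => z.1 * z.2) : Ultrafilter G) : (Psi G).Quotient) =
      (r.map Prod.fst : Ultrafilter G) * (r.map Prod.snd : Ultrafilter G) := by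
  obtain ⟨c, hc⟩ := exists_mul_mul_eq_self Ultrafilter.continuous_mul_left
    (r.map (fun z => z.1 * z.2))
  have h₁ := (isSchur_mul_mul r hc).coe_eq
  have h₂ := congrArg (fun p : Ultrafilter G => (p : (Psi G).Quotient)) hc
  simp only [coe_ultrafilter_mul, coe_pure_one] at h₁ h₂
  -- In the group of classes, `c * w * c = c` makes `w` the inverse of `c`, while `v * c * u = 1`
  -- gives `c * u * v = 1` by cyclic rotation.
  have h₃ := eq_inv_of_mul_eq_one_right (mul_eq_right.1 h₂)
  rw [h₃, inv_eq_iff_mul_eq_one, ← mul_assoc]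
  exact mul_eq_one_comm.1 ((mul_assoc _ _ _).symm.trans h₁)

theorem coe_map_inv (p : Ultrafilter G) :
    ((p.map (fun x => x⁻¹) : Ultrafilter G) : (Psi G).Quotient) = (p : (Psi G).Quotient)⁻¹ := by
  -- On this antidiagonal ultrafilter the multiplication is constantly `1`.
  have h := coe_map_mul (p.map fun x => (x⁻¹, x))
  simp only [Ultrafilter.map_map] at h
  refine eq_inv_of_mul_eq_one_left (Eq.trans (Eq.symm h) ?_)
  rw [← coe_pure_one]
  congr 1
  refine Ultrafilter.coe_inj.1 ?_
  simp [Function.comp_def, Filter.map_const]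

/-- The map `marginals` is a continuous surjection from a compact space to a Hausdorff one, hence a
quotient map, so joint continuity can be tested after composing with it. -/
instance isTopologicalGroup_quotient : IsTopologicalGroup (Psi G).Quotient where
  continuous_mul := by
    let marginals : Ultrafilter (G × G) → (Psi G).Quotient × (Psi G).Quotient :=
      fun r => ((r.map Prod.fst : Ultrafilter G), (r.map Prod.snd : Ultrafilter G))
    have hcont : Continuous marginals :=
      (isQuotientMap_coe.continuous.comp (continuous_ultrafilter_map _)).prodMk
        (isQuotientMap_coe.continuous.comp (continuous_ultrafilter_map _))
    have hsurj : Function.Surjective marginals := by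
      rintro ⟨a, b⟩
      obtain ⟨p, rfl⟩ := isQuotientMap_coe.surjective a
      obtain ⟨q, rfl⟩ := isQuotientMap_coe.surjective b
      obtain ⟨r, rfl, rfl⟩ := exists_map_fst_map_snd p q
      exact ⟨r, rfl⟩
    rw [(hcont.isClosedMap.isQuotientMap hcont hsurj).continuous_iff]
    refine (isQuotientMap_coe.continuous.comp
      (continuous_ultrafilter_map fun z : G × G => z.1 * z.2)).congr fun r => ?_
    exact coe_map_mul r
  continuous_inv := by
    rw [isQuotientMap_coe.continuous_iff]
    exact (isQuotientMap_coe.continuous.comp (continuous_ultrafilter_map _)).congr coe_map_inv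

variable (G) in
/-- The homomorphism sending `x` to the class of the principal ultrafilter at `x`. -/
noncomputable def toQuotient : G →* (Psi G).Quotient where
  toFun x := ((pure x : Ultrafilter G) : (Psi G).Quotient)
  map_one' := rfl
  map_mul' x y := by
    rw [← coe_ultrafilter_mul]
    congr 1

theorem continuous_toQuotient [IsTopologicalGroup G] : Continuous (toQuotient G) := by
  refine continuous_of_continuousAt_one _ (tendsto_iff_ultrafilter _ _ _ |>.2 fun p hp => ?_)
  -- Principal ultrafilters converge to `p` along `p`, and the class of `p` is `1` because `p`
  -- converges to `1`.
  have h := (isQuotientMap_coe (G := G)).continuous.continuousAt.tendsto.comp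
    p.tendsto_pure_self
  rw [map_one, ← coe_pure_one, ← coe_eq_of_le_nhds_one hp]
  exact h

theorem denseRange_toQuotient : DenseRange (toQuotient G) :=
  isQuotientMap_coe.surjective.denseRange.comp denseRange_pure isQuotientMap_coe.continuous

theorem extend_eq_of_Psi {H : Type w} [Group H] [TopologicalSpace H] [IsTopologicalGroup H]
    [CompactSpace H] [T2Space H] (f : G →* H) (hf : Continuous f) {p q : Ultrafilter G}
    (hpq : Psi G p q) : Ultrafilter.extend f p = Ultrafilter.extend f q := by
  let F : Ultrafilter G →ₙ* H := ⟨Ultrafilter.extend f, extend_mul f⟩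
  have hF : Continuous F := continuous_ultrafilter_extend f
  have hle : Psi G ≤ Con.ker F := by
    refine (isLeast_leastClosedCon _).2 ⟨?_, ?_⟩
    · exact isClosed_eq (hF.comp continuous_fst) (hF.comp continuous_snd)
    · rintro p _ ⟨hp, rfl⟩
      refine (Con.ker_rel F).2 ?_
      change Ultrafilter.extend f p = Ultrafilter.extend f (pure 1)
      rw [ultrafilter_extend_pure, map_one]
      rcases hp with hp | hp
      · exact hp.extend_eq_one f
      · rw [ultrafilter_extend_eq_iff, ← map_one f]
        exact (hf.tendsto 1).mono_left hp
  exact (Con.ker_rel F).1 (hle hpq)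

theorem isBohrCompactification_toQuotient [IsTopologicalGroup G] :
    IsBohrCompactification.{u, u, w} (toQuotient G) where
  isTopologicalGroup := inferInstance
  compactSpace := inferInstance
  t2Space := inferInstance
  continuous := continuous_toQuotient
  denseRange := denseRange_toQuotient
  exists_lift H _ _ _ _ _ f hf := by
    let g : (Psi G).Quotient → H :=
      Quotient.lift (Ultrafilter.extend f) fun _ _ h => extend_eq_of_Psi f hf h
    refine ⟨MonoidHom.mk' g fun a b => ?_, ?_, fun x => ultrafilter_extend_pure f x⟩
    · obtain ⟨p, rfl⟩ := isQuotientMap_coe.surjective a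
      obtain ⟨q, rfl⟩ := isQuotientMap_coe.surjective b
      exact extend_mul f p q
    · exact isQuotientMap_coe.continuous_iff.2 (continuous_ultrafilter_extend f)

end Quotient

end BohrUltrafilter

/-- For every topological group `G`, the quotient semigroup of the Stone-Čech compactification of
the discrete group `G` by `Ψ` is a group, the map sending `x` to the class of the principal
ultrafilter at `x` is a homomorphism, and together they form the Bohr compactification of `G`. -/
theorem theorem2p5 (G : Type u) [Group G] [TopologicalSpace G] [IsTopologicalGroup G] :
    ∃ grp : Group (BohrUltrafilter.Psi G).Quotient,
      grp.toMul = Con.hasMul (BohrUltrafilter.Psi G) ∧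
      ∃ b : G →* (BohrUltrafilter.Psi G).Quotient,
        (∀ x : G, b x = ((pure x : Ultrafilter G) : (BohrUltrafilter.Psi G).Quotient)) ∧
        BohrUltrafilter.IsBohrCompactification.{u, u, w} b :=
  ⟨BohrUltrafilter.quotientGroup G, rfl, BohrUltrafilter.toQuotient G, fun _ => rfl,
    BohrUltrafilter.isBohrCompactification_toQuotient⟩
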